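/- For a probability distribution $\mathcal D$ on $\mathbb R^d$ ($d\ge 2$) with finite fourth moments, let $\lambda_1\ge\lambda_2\ge\dots\ge\lambda_d$ be the eigenvalues of $\Sigma=\mathbb E_{a\sim\mathcal D}[aa^\top]$, let $\mathrm{gap}(\mathcal D)=(\lambda_1-\lambda_2)/\lambda_1$, and let $$\mathrm v(\mathcal D)=\frac{\big\|\mathbb E_{a\sim\mathcal D}[(aa^\top)^2]\big\|_2}{\big\|\mathbb E_{a\sim\mathcal D}[aa^\top]\big\|_2^2},$$ where $\|\cdot\|_2$ is the spectral norm of a matrix. **Theorem.** There is a universal constant $c>0$ such that for every dimension $d\ge2$ and every $g$ with $0<g<0.9$ there is an $N=N(d,g)$ such that the following holds for all $n\ge N$. For every estimator $\hat v=\hat v(a_1,\dots,a_n)\in\mathbb R^d$ (possibly randomized) there is a distribution $\mathcal D$ on $\mathbb R^d$ with $\mathrm{gap}(\mathcal D)=g$ for which, if $a_1,\dots,a_n$ are independent samples from $\mathcal D$ and $v_1$ is a unit top eigenvector of $\mathbb E_{a\sim\mathcal D}[aa^\top]$, $$\mathbb E\Big[\min\big(\|\hat v-v_1\|_2^2,\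 \|\hat v+v_1\|_2^2\big)\Big]\ \ge\ c\,\frac{\mathrm v(\mathcal D)}{g^2\,n}.$$ In particular $\mathbb E\|\hat v-v_1\|_2^2\ge c\,\mathrm v(\mathcal D)/(g^2n)$ for either choice of the sign of $v_1$. Moreover $\mathcal D$ can be taken to be a Gaussian spike model, that is, the law of $\sqrt\theta\,\iota\,v^\star+Z$ with $\theta>0$, a unit vector $v^\star$ (which is then a top eigenvector $v_1$), and independent $\iota\sim\mathcal N(0,1)$, $Z\sim\mathcal N(0,I_d)$. -/

import Mathlib

open MeasureTheory ProbabilityTheory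
open scoped ENNReal

noncomputable section

namespace OnlinePCA

/-- The rank-one matrix `a aᵀ`. -/
def outer {d : ℕ} (a : EuclideanSpace ℝ (Fin d)) : Matrix (Fin d) (Fin d) ℝ :=
  Matrix.vecMulVec a.ofLp a.ofLp

/-- The covariance matrix `Σ = 𝔼[a aᵀ]` of a distribution `D` on `ℝᵈ` (entrywise expectation). -/
def covMatrix {d : ℕ} (D : Measure (EuclideanSpace ℝ (Fin d))) : Matrix (Fin d) (Fin d) ℝ :=
  Matrix.of fun i j => ∫ a, outer a i j ∂D

/-- The matrix `𝔼[(a aᵀ)²]` (entrywise expectation). -/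
def fourthMatrix {d : ℕ} (D : Measure (EuclideanSpace ℝ (Fin d))) :
    Matrix (Fin d) (Fin d) ℝ :=
  Matrix.of fun i j => ∫ a, (outer a ^ 2) i j ∂D

theorem covMatrix_isHermitian {d : ℕ} (D : Measure (EuclideanSpace ℝ (Fin d))) :
    (covMatrix D).IsHermitian := by
  ext i j
  simp [covMatrix, outer, Matrix.vecMulVec_apply, mul_comm]

/-- The eigenvalues of `𝔼[a aᵀ]` with multiplicity, in decreasing order: the paper's
`λ₁ ≥ λ₂ ≥ …` are `covEigenvalue D 0, covEigenvalue D 1, …`. -/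
def covEigenvalue {d : ℕ} (D : Measure (EuclideanSpace ℝ (Fin d))) (i : Fin d) : ℝ :=
  (covMatrix_isHermitian D).eigenvalues₀ (Fin.cast (Fintype.card_fin d).symm i)

/-- The eigenvalue gap `(λ₁ - λ₂) / λ₁`; the dimension has to be at least two. -/
def eigengap {d : ℕ} (hd : 2 ≤ d) (D : Measure (EuclideanSpace ℝ (Fin d))) : ℝ :=
  (covEigenvalue D ⟨0, by omega⟩ - covEigenvalue D ⟨1, by omega⟩) / covEigenvalue D ⟨0, by omega⟩

/-- `v` is a unit eigenvector of `𝔼[a aᵀ]` for its largest eigenvalue. -/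
def IsTopEigenvector {d : ℕ} (hd : 2 ≤ d) (D : Measure (EuclideanSpace ℝ (Fin d)))
    (v : EuclideanSpace ℝ (Fin d)) : Prop :=
  ‖v‖ = 1 ∧ Matrix.toEuclideanCLM (𝕜 := ℝ) (covMatrix D) v = covEigenvalue D ⟨0, by omega⟩ • v

/-- The spectral norm of a matrix. -/
def specNorm {d : ℕ} (M : Matrix (Fin d) (Fin d) ℝ) : ℝ :=
  ‖Matrix.toEuclideanCLM (𝕜 := ℝ) M‖

/-- The variance parameter `v(D) = ‖𝔼[(a aᵀ)²]‖₂ / ‖𝔼[a aᵀ]‖₂²`. -/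
def nvar {d : ℕ} (D : Measure (EuclideanSpace ℝ (Fin d))) : ℝ :=
  specNorm (fourthMatrix D) / specNorm (covMatrix D) ^ 2

/-- The Gaussian spike model: the law of `√θ ι v + Z` with `ι ∼ N(0, 1)` and `Z ∼ N(0, I_d)`
independent. -/
def gaussianSpike {d : ℕ} (θ : ℝ) (v : EuclideanSpace ℝ (Fin d)) :
    Measure (EuclideanSpace ℝ (Fin d)) :=
  ((gaussianReal 0 1).prod (stdGaussian (EuclideanSpace ℝ (Fin d)))).map
    (fun p => (Real.sqrt θ * p.1) • v + p.2)

/-- The squared distance of `w` to `v`, an eigenvector being determined only up to sign. -/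
def signLoss {d : ℕ} (w v : EuclideanSpace ℝ (Fin d)) : ℝ :=
  min (‖w - v‖ ^ 2) (‖w + v‖ ^ 2)

/-- The expected loss of an estimator of `v` from `n` independent samples of `D`. The estimator may
be randomized: it maps a sample `a` to a distribution `κ a` of its output. An estimator that is a
measurable function of the sample is the case of a deterministic kernel. -/
def risk {d n : ℕ} (D : Measure (EuclideanSpace ℝ (Fin d)))
    (κ : Kernel (Fin n → EuclideanSpace ℝ (Fin d)) (EuclideanSpace ℝ (Fin d)))
    (v : EuclideanSpace ℝ (Fin d)) : ℝ≥0∞ :=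
  ∫⁻ a, ∫⁻ w, ENNReal.ofReal (signLoss w v) ∂(κ a) ∂(Measure.pi fun _ : Fin n => D)

end OnlinePCA

end

namespace OnlinePCA

open scoped NNReal RealInnerProductSpace

variable {d : ℕ}

/-! The bound is Assouad's method over spikes with a common θ, where θ/(1+θ) = g. The directions
`spikeDir` share one dominant coordinate and have ±δ in the other d - 1. Put q = θ²/(1+θ) =
g²/(1-g). Flipping one sign gives n-sample laws at Kullback–Leibler divergence at most 2nqδ², so for
δ² = 1/(4nq) no test reads the sign reliably: by `two_point_lower_bound` its two error probabilities
sum to at least 1/8. Averaging over the cube (`exists_card_mul_le_two_mul_sum`) finds a direction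
whose d - 1 error probabilities sum to at least (d-1)/16. Each misread sign costs δ², even modulo
the global sign (`sum_errorSet_le_signLoss`), so the risk is at least (d-1)/(64nq).

Since g < 0.9, 1/q exceeds 1/(10g²) and θ ≤ 9. The latter makes all fourth moments of unit marginals
bounded, so the variance parameter is at most a constant times d (`nvar_gaussianSpike_le`). The d -
1 unreadable signs pay for this factor d. -/

/-! ### Characteristic function and marginals of the spike model -/

instance isProbabilityMeasure_gaussianSpike (θ : ℝ) (v : EuclideanSpace ℝ (Fin d)) :
    IsProbabilityMeasure (gaussianSpike θ v) :=
  Measure.isProbabilityMeasure_map (by fun_prop)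

theorem charFun_gaussianSpike {θ : ℝ} (hθ : 0 ≤ θ) (v t : EuclideanSpace ℝ (Fin d)) :
    charFun (gaussianSpike θ v) t =
      Complex.exp (-((‖t‖ ^ 2 + θ * ⟪v, t⟫ ^ 2 : ℝ) : ℂ) / 2) := by
  have h : gaussianSpike θ v =
      (((gaussianReal 0 1).map (fun x : ℝ => (√θ * x) • v)).prod
        (stdGaussian (EuclideanSpace ℝ (Fin d)))).map (fun p => p.1 + p.2) := by
    have hp := Measure.map_prod_map (gaussianReal 0 1) (stdGaussian (EuclideanSpace ℝ (Fin d)))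
      (f := fun x : ℝ => (√θ * x) • v) (g := id) (by fun_prop) measurable_id
    rw [Measure.map_id] at hp
    rw [hp, Measure.map_map (by fun_prop) (by fun_prop)]
    rfl
  have : IsProbabilityMeasure ((gaussianReal 0 1).map (fun x : ℝ => (√θ * x) • v)) :=
    Measure.isProbabilityMeasure_map (by fun_prop)
  rw [h, charFun_map_add_prod_eq_mul, Pi.mul_apply, charFun_stdGaussian, charFun_apply,
    integral_map (by fun_prop) (by fun_prop)]
  have : ∀ x : ℝ, ⟪(√θ * x) • v, t⟫ = (√θ * ⟪v, t⟫) * x := fun x => by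
    rw [real_inner_smul_left]; ring
  simp_rw [this, Complex.ofReal_mul (√θ * ⟪v, t⟫)]
  rw [← charFun_apply_real, charFun_gaussianReal, ← Complex.exp_add]
  have h2 : ((√θ : ℝ) : ℂ) ^ 2 = θ := by exact_mod_cast Real.sq_sqrt hθ
  congr 1
  push_cast
  rw [mul_pow, h2]
  ring

theorem map_inner_gaussianSpike {θ : ℝ} (hθ : 0 ≤ θ) (v u : EuclideanSpace ℝ (Fin d)) :
    (gaussianSpike θ v).map (fun a => ⟪u, a⟫) =
      gaussianReal 0 (‖u‖ ^ 2 + θ * ⟪v, u⟫ ^ 2).toNNReal := by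
  have : IsProbabilityMeasure ((gaussianSpike θ v).map (fun a => ⟪u, a⟫)) :=
    Measure.isProbabilityMeasure_map (by fun_prop)
  apply Measure.ext_of_charFun
  ext s
  rw [charFun_apply_real, integral_map (by fun_prop) (by fun_prop), charFun_gaussianReal,
    Real.coe_toNNReal _ (by positivity)]
  have : ∀ a : EuclideanSpace ℝ (Fin d), (s : ℂ) * (⟪u, a⟫ : ℝ) = (⟪a, s • u⟫ : ℝ) := fun a => by
    rw [real_inner_smul_right, real_inner_comm]; push_cast; ring
  simp_rw [this]
  rw [← charFun_apply, charFun_gaussianSpike hθ, norm_smul, real_inner_smul_right]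
  congr 1
  simp only [mul_pow, Real.norm_eq_abs, sq_abs]
  push_cast
  ring

/-! ### Density of a spike with respect to the standard Gaussian -/

/-- On a box the restricted density is a product of functions of independent coordinates, so its
integral factors. -/
theorem pi_withDensity {ι : Type*} [Fintype ι] {X : ι → Type*} [∀ i, MeasurableSpace (X i)]
    (μ : ∀ i, Measure (X i)) [∀ i, IsProbabilityMeasure (μ i)] {f : ∀ i, X i → ℝ≥0∞}
    (hf : ∀ i, Measurable (f i)) (hσ : ∀ i, SigmaFinite ((μ i).withDensity (f i))) :
    Measure.pi (fun i => (μ i).withDensity (f i)) =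
      (Measure.pi μ).withDensity fun x => ∏ i, f i (x i) := by
  refine Measure.pi_eq fun s hs => ?_
  rw [withDensity_apply _ (.univ_pi hs), ← lintegral_indicator (.univ_pi hs)]
  have h : (Set.univ.pi s).indicator (fun x => ∏ i, f i (x i)) =
      fun x => ∏ i, (s i).indicator (f i) (x i) := by
    ext x
    by_cases hx : x ∈ Set.univ.pi s
    · rw [Set.indicator_of_mem hx]
      exact Finset.prod_congr rfl fun i _ => (Set.indicator_of_mem (hx i trivial) _).symm
    · rw [Set.indicator_of_notMem hx]
      simp only [Set.mem_pi, not_forall] at hx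
      obtain ⟨i, _, hi⟩ := hx
      exact (Finset.prod_eq_zero (Finset.mem_univ i) (Set.indicator_of_notMem hi _)).symm
  have hm : ∀ i, Measurable ((s i).indicator (f i)) := fun i => (hf i).indicator (hs i)
  have hind := iIndepFun_pi (μ := μ) (X := fun i => (s i).indicator (f i))
    (fun i => (hm i).aemeasurable)
  rw [h, lintegral_prod_eq_prod_lintegral_of_indepFun _ _ hind
    (fun i => (hm i).comp (measurable_pi_apply i))]
  refine Finset.prod_congr rfl fun i _ => ?_
  rw [withDensity_apply _ (hs i), ← lintegral_indicator (hs i),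
    (measurePreserving_eval μ i).lintegral_comp (hm i)]

theorem gaussianReal_eq_withDensity {θ : ℝ} (hθ : 0 ≤ θ) :
    gaussianReal 0 (1 + θ).toNNReal = (gaussianReal 0 1).withDensity fun x =>
      ENNReal.ofReal ((√(1 + θ))⁻¹ * Real.exp (θ / (1 + θ) / 2 * x ^ 2)) := by
  have h0 : (1 + θ).toNNReal ≠ 0 := by simp; linarith
  rw [gaussianReal_of_var_ne_zero _ h0, gaussianReal_of_var_ne_zero _ one_ne_zero,
    ← withDensity_mul _ (by fun_prop) (by fun_prop)]
  congr 1
  ext x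
  rw [Pi.mul_apply, gaussianPDF, gaussianPDF, ← ENNReal.ofReal_mul (gaussianPDFReal_nonneg _ _ _)]
  congr 1
  have hp : 0 < 1 + θ := by linarith
  simp only [gaussianPDFReal, Real.coe_toNNReal _ hp.le, NNReal.coe_one]
  rw [Real.sqrt_mul' _ hp.le, mul_one, mul_inv]
  rw [show (√(2 * Real.pi))⁻¹ * Real.exp (-(x - 0) ^ 2 / (2 * 1)) *
      ((√(1 + θ))⁻¹ * Real.exp (θ / (1 + θ) / 2 * x ^ 2)) = (√(2 * Real.pi))⁻¹ * (√(1 + θ))⁻¹ *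
      (Real.exp (-(x - 0) ^ 2 / (2 * 1)) * Real.exp (θ / (1 + θ) / 2 * x ^ 2)) by ring, ← Real.exp_add]
  congr 2
  field_simp
  ring

theorem map_withDensity_comp {α β : Type*} [MeasurableSpace α] [MeasurableSpace β]
    (μ : Measure α) {T : α → β} (hT : Measurable T) {f : β → ℝ≥0∞} (hf : Measurable f) :
    (μ.withDensity (f ∘ T)).map T = (μ.map T).withDensity f := by
  ext s hs
  rw [Measure.map_apply hT hs, withDensity_apply _ (hT hs), withDensity_apply _ hs,
    setLIntegral_map hs hf hT]
  rfl

theorem exists_orthonormalBasis_apply_eq (i : Fin d) {v : EuclideanSpace ℝ (Fin d)}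
    (hv : ‖v‖ = 1) :
    ∃ b : OrthonormalBasis (Fin d) ℝ (EuclideanSpace ℝ (Fin d)), b i = v := by
  obtain ⟨b, hb⟩ := Orthonormal.exists_orthonormalBasis_extension_of_card_eq (𝕜 := ℝ)
    (E := EuclideanSpace ℝ (Fin d)) (ι := Fin d) (by simp) (v := fun _ => v) (s := {i})
    ⟨fun _ => hv, fun j k hjk => (hjk (Subsingleton.elim j k)).elim⟩
  exact ⟨b, hb i rfl⟩

theorem gaussianSpike_eq_map_pi {θ : ℝ} (hθ : 0 ≤ θ) (i : Fin d) {v : EuclideanSpace ℝ (Fin d)}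
    (b : OrthonormalBasis (Fin d) ℝ (EuclideanSpace ℝ (Fin d))) (hb : b i = v) :
    gaussianSpike θ v =
      (Measure.pi fun j => gaussianReal 0 (if j = i then (1 + θ).toNNReal else 1)).map
        (fun x => ∑ j, x j • b j) := by
  have : IsProbabilityMeasure
      ((Measure.pi fun j => gaussianReal 0 (if j = i then (1 + θ).toNNReal else 1)).map
        (fun x : Fin d → ℝ => ∑ j, x j • b j)) :=
    Measure.isProbabilityMeasure_map (Measurable.aemeasurable (by fun_prop))
  apply Measure.ext_of_charFun
  ext t
  rw [charFun_gaussianSpike hθ, charFun_apply,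
    integral_map (Measurable.aemeasurable (by fun_prop))
      (Measurable.aestronglyMeasurable (by fun_prop))]
  simp_rw [sum_inner, Complex.ofReal_sum, Finset.sum_mul, Complex.exp_sum,
    integral_fintype_prod_eq_prod (f := fun i x ↦ Complex.exp (⟪x • b i, t⟫ * Complex.I)),
    real_inner_smul_left, mul_comm _ (⟪_, _⟫), Complex.ofReal_mul, ← charFun_apply_real,
    charFun_gaussianReal]
  rw [← Complex.exp_sum]
  congr 1
  rw [← b.sum_sq_inner_right t, ← hb]
  have : ∀ j, ((⟪b j, t⟫ : ℝ) : ℂ) * ((0 : ℝ) : ℂ) * Complex.I -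
      (((if j = i then (1 + θ).toNNReal else 1 : ℝ≥0) : ℝ) : ℂ) * (⟪b j, t⟫ : ℝ) ^ 2 / 2 =
      -((⟪b j, t⟫ ^ 2 + if j = i then θ * ⟪b j, t⟫ ^ 2 else 0 : ℝ) : ℂ) / 2 := fun j => by
    split_ifs
    · rw [Real.coe_toNNReal _ (by linarith)]; push_cast; ring
    · push_cast; ring
  simp_rw [this]
  rw [← Finset.sum_div, Finset.sum_neg_distrib, ← Complex.ofReal_sum, Finset.sum_add_distrib]
  simp

/-- In an orthonormal basis containing v the coordinates are independent, and only the one along v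
is not standard. The normalising constant does not depend on v, so it cancels between two spikes. -/
theorem gaussianSpike_eq_withDensity {θ : ℝ} (hθ : 0 ≤ θ) (hd : 0 < d)
    {v : EuclideanSpace ℝ (Fin d)} (hv : ‖v‖ = 1) :
    gaussianSpike θ v = (stdGaussian (EuclideanSpace ℝ (Fin d))).withDensity fun z =>
      ENNReal.ofReal ((√(1 + θ))⁻¹ * Real.exp (θ / (1 + θ) / 2 * ⟪v, z⟫ ^ 2)) := by
  let i : Fin d := ⟨0, hd⟩
  obtain ⟨b, hb⟩ := exists_orthonormalBasis_apply_eq i hv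
  let f : Fin d → ℝ → ℝ≥0∞ := fun j x => if j = i then
    ENNReal.ofReal ((√(1 + θ))⁻¹ * Real.exp (θ / (1 + θ) / 2 * x ^ 2)) else 1
  have hf : ∀ j, Measurable (f j) := fun j => by
    dsimp only [f]; split_ifs <;> fun_prop
  have h1 : (fun j => gaussianReal 0 (if j = i then (1 + θ).toNNReal else 1)) =
      fun j => (gaussianReal 0 1).withDensity (f j) := by
    ext1 j
    dsimp only [f]
    split_ifs
    · exact gaussianReal_eq_withDensity hθ
    · exact withDensity_one.symm
  have : ∀ j, SigmaFinite ((gaussianReal 0 1).withDensity (f j)) := fun j => by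
    rw [← congrFun h1 j]; infer_instance
  rw [gaussianSpike_eq_map_pi hθ i b hb, h1, pi_withDensity _ hf this,
    stdGaussian_eq_map_pi_orthonormalBasis b, ← map_withDensity_comp _ (by fun_prop) (by fun_prop)]
  congr 2
  ext x
  rw [Finset.prod_eq_single i (fun j _ hj => by simp [f, hj]) (by simp)]
  have : ⟪v, ∑ j, x j • b j⟫ = x i := by
    rw [← hb, inner_sum]
    simp_rw [real_inner_smul_right]
    rw [Finset.sum_eq_single i (fun j _ hj => by simp [b.inner_eq_zero hj.symm]) (by simp)]
    simp
  simp [f, this]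

/-! ### Moments of the marginals -/

theorem integrable_pow_gaussianReal (m : ℝ) (s : ℝ≥0) (k : ℕ) :
    Integrable (fun x => x ^ k) (gaussianReal m s) :=
  integrable_pow_of_mem_interior_integrableExpSet (X := id) (by simp) k

theorem integrable_inner_pow_gaussianSpike {θ : ℝ} (hθ : 0 ≤ θ) (v u : EuclideanSpace ℝ (Fin d))
    (k : ℕ) : Integrable (fun a => ⟪u, a⟫ ^ k) (gaussianSpike θ v) := by
  have h : Integrable (fun x : ℝ => x ^ k) ((gaussianSpike θ v).map (fun a => ⟪u, a⟫)) := by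
    rw [map_inner_gaussianSpike hθ]
    exact integrable_pow_gaussianReal _ _ k
  exact h.comp_measurable (by fun_prop)

theorem integral_inner_sq_gaussianSpike {θ : ℝ} (hθ : 0 ≤ θ) (v u : EuclideanSpace ℝ (Fin d)) :
    ∫ a, ⟪u, a⟫ ^ 2 ∂(gaussianSpike θ v) = ‖u‖ ^ 2 + θ * ⟪v, u⟫ ^ 2 := by
  have h := integral_map (μ := gaussianSpike θ v) (φ := fun a => ⟪u, a⟫) (by fun_prop)
    (f := fun x : ℝ => x ^ 2) (by fun_prop)
  rw [← h, map_inner_gaussianSpike hθ]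
  have h2 := variance_fun_id_gaussianReal (μ := 0) (v := (‖u‖ ^ 2 + θ * ⟪v, u⟫ ^ 2).toNNReal)
  rw [variance_eq_integral (by fun_prop)] at h2
  simp only [integral_id_gaussianReal, sub_zero] at h2
  rw [h2, Real.coe_toNNReal _ (by positivity)]

theorem pow_four_le_exp_add_exp_neg (x : ℝ) : x ^ 4 ≤ 24 * (Real.exp x + Real.exp (-x)) := by
  have h := Real.pow_div_factorial_le_exp |x| (abs_nonneg x) 4
  have h2 : Real.exp |x| ≤ Real.exp x + Real.exp (-x) := by
    rcases abs_choice x with h | h <;> rw [h] <;> linarith [Real.exp_pos x, Real.exp_pos (-x)]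
  have h3 : |x| ^ 4 = x ^ 4 := by rw [pow_abs]; exact abs_of_nonneg (by positivity)
  have h4 : ((Nat.factorial 4 : ℕ) : ℝ) = 24 := by norm_num [Nat.factorial]
  rw [h3, h4] at h
  linarith

/-- The moment generating function at ±1 suffices: only boundedness for s ≤ 10 is needed later, not
the exact value. -/
theorem integral_pow_four_gaussianReal_le (s : ℝ≥0) :
    ∫ x, x ^ 4 ∂(gaussianReal 0 s) ≤ 48 * Real.exp (s / 2) := by
  have h1 := integrable_exp_mul_gaussianReal (μ := 0) (v := s) 1
  have h2 := integrable_exp_mul_gaussianReal (μ := 0) (v := s) (-1)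
  have m1 := congrFun (mgf_fun_id_gaussianReal (μ := 0) (v := s)) 1
  have m2 := congrFun (mgf_fun_id_gaussianReal (μ := 0) (v := s)) (-1)
  simp only [mgf, one_mul, neg_mul] at h1 h2 m1 m2
  calc ∫ x, x ^ 4 ∂(gaussianReal 0 s)
      ≤ ∫ x, 24 * (Real.exp x + Real.exp (-x)) ∂(gaussianReal 0 s) :=
        integral_mono (integrable_pow_gaussianReal 0 s 4) ((h1.add h2).const_mul 24)
          pow_four_le_exp_add_exp_neg
    _ = 48 * Real.exp (s / 2) := by
        rw [integral_const_mul, integral_add h1 h2, m1, m2]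
        norm_num
        ring

theorem integral_inner_pow_four_gaussianSpike_le {θ : ℝ} (hθ : 0 ≤ θ) (hθ9 : θ ≤ 9)
    {v u : EuclideanSpace ℝ (Fin d)} (hv : ‖v‖ = 1) (hu : ‖u‖ = 1) :
    ∫ a, ⟪u, a⟫ ^ 4 ∂(gaussianSpike θ v) ≤ 48 * Real.exp 5 := by
  have h := integral_map (μ := gaussianSpike θ v) (φ := fun a => ⟪u, a⟫) (by fun_prop)
    (f := fun x : ℝ => x ^ 4) (by fun_prop)
  rw [← h, map_inner_gaussianSpike hθ]
  refine (integral_pow_four_gaussianReal_le _).trans ?_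
  gcongr
  rw [Real.coe_toNNReal _ (by positivity), hu]
  -- The marginal variance is at most 1 + θ ≤ 10, whence the exponent 5.
  have h1 : |⟪v, u⟫| ≤ 1 := by simpa [hv, hu] using abs_real_inner_le_norm v u
  have h2 : ⟪v, u⟫ ^ 2 ≤ 1 := by rw [← sq_abs]; exact pow_le_one₀ (abs_nonneg _) h1
  nlinarith

theorem integral_inner_mul_inner_gaussianSpike {θ : ℝ} (hθ : 0 ≤ θ)
    (v u w : EuclideanSpace ℝ (Fin d)) :
    ∫ a, ⟪u, a⟫ * ⟪w, a⟫ ∂(gaussianSpike θ v) = ⟪u, w⟫ + θ * (⟪v, u⟫ * ⟪v, w⟫) := by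
  have h : ∀ a : EuclideanSpace ℝ (Fin d), ⟪u, a⟫ * ⟪w, a⟫ =
      (⟪u + w, a⟫ ^ 2 - ⟪u, a⟫ ^ 2 - ⟪w, a⟫ ^ 2) / 2 := fun a => by
    rw [inner_add_left]; ring
  have hi := fun x => integrable_inner_pow_gaussianSpike hθ v x 2
  have hs : Integrable (fun a => ⟪u + w, a⟫ ^ 2 - ⟪u, a⟫ ^ 2) (gaussianSpike θ v) :=
    (hi _).sub (hi _)
  simp_rw [h]
  rw [integral_div, integral_sub hs (hi _), integral_sub (hi _) (hi _)]
  simp_rw [integral_inner_sq_gaussianSpike hθ]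
  rw [norm_add_sq_real, inner_add_right]
  ring

/-! ### The covariance matrix and its spectrum -/

theorem ofLp_apply_eq_inner_single (a : EuclideanSpace ℝ (Fin d)) (i : Fin d) :
    a.ofLp i = ⟪EuclideanSpace.single i (1 : ℝ), a⟫ := by
  rw [EuclideanSpace.inner_single_left]; simp

theorem covMatrix_gaussianSpike {θ : ℝ} (hθ : 0 ≤ θ) (v : EuclideanSpace ℝ (Fin d)) :
    covMatrix (gaussianSpike θ v) = 1 + θ • outer v := by
  ext i j
  simp only [covMatrix, outer, Matrix.of_apply, Matrix.vecMulVec_apply]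
  simp_rw [ofLp_apply_eq_inner_single]
  rw [integral_inner_mul_inner_gaussianSpike hθ]
  rw [EuclideanSpace.inner_single_left, EuclideanSpace.inner_single_right,
    EuclideanSpace.inner_single_right]
  simp [Matrix.one_apply, Matrix.vecMulVec_apply]

theorem toEuclideanCLM_covMatrix_gaussianSpike {θ : ℝ} (hθ : 0 ≤ θ)
    (v x : EuclideanSpace ℝ (Fin d)) :
    Matrix.toEuclideanCLM (𝕜 := ℝ) (covMatrix (gaussianSpike θ v)) x =
      x + (θ * ⟪v, x⟫) • v := by
  ext i
  rw [covMatrix_gaussianSpike hθ, Matrix.ofLp_toEuclideanCLM]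
  simp only [outer, Matrix.add_mulVec, Matrix.one_mulVec, Matrix.smul_mulVec,
    Matrix.vecMulVec_mulVec, Pi.add_apply, Pi.smul_apply, PiLp.add_apply, PiLp.smul_apply,
    MulOpposite.smul_eq_mul_unop, MulOpposite.unop_op, smul_eq_mul]
  rw [EuclideanSpace.inner_eq_star_dotProduct, dotProduct_comm]
  simp
  ring

theorem trace_covMatrix_gaussianSpike {θ : ℝ} (hθ : 0 ≤ θ) {v : EuclideanSpace ℝ (Fin d)}
    (hv : ‖v‖ = 1) : (covMatrix (gaussianSpike θ v)).trace = d + θ := by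
  rw [covMatrix_gaussianSpike hθ, Matrix.trace_add, Matrix.trace_smul, outer,
    Matrix.trace_vecMulVec]
  have : v.ofLp ⬝ᵥ v.ofLp = 1 := by
    have := EuclideanSpace.inner_eq_star_dotProduct v v
    rw [real_inner_self_eq_norm_sq, hv] at this
    simpa using this.symm
  simp [this]

/-- The eigenvalues of a spiked covariance are `1` and `1 + θ`. -/
theorem eigenvalues_gaussianSpike {θ : ℝ} (hθ : 0 ≤ θ) {v : EuclideanSpace ℝ (Fin d)}
    (hv : ‖v‖ = 1) (i : Fin d) :
    (covMatrix_isHermitian (gaussianSpike θ v)).eigenvalues i = 1 ∨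
      (covMatrix_isHermitian (gaussianSpike θ v)).eigenvalues i = 1 + θ := by
  set hA := covMatrix_isHermitian (gaussianSpike θ v)
  set x := hA.eigenvectorBasis i
  set l := hA.eigenvalues i
  have h : x + (θ * ⟪v, x⟫) • v = l • x := by
    rw [← toEuclideanCLM_covMatrix_gaussianSpike hθ]
    ext j
    rw [Matrix.ofLp_toEuclideanCLM, hA.mulVec_eigenvectorBasis i]
    rfl
  have hx : ‖x‖ = 1 := hA.eigenvectorBasis.orthonormal.1 i
  have h1 : (1 + θ) * ⟪v, x⟫ = l * ⟪v, x⟫ := by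
    have := congrArg (fun y => ⟪v, y⟫) h
    simp only [inner_add_right, real_inner_smul_right, real_inner_self_eq_norm_sq, hv] at this
    linarith
  by_cases h0 : ⟪v, x⟫ = 0
  · left
    rw [h0, mul_zero, zero_smul, add_zero] at h
    have h2 := congrArg (fun y => ⟪x, y⟫) h
    simp only [real_inner_smul_right, real_inner_self_eq_norm_sq, hx] at h2
    linarith
  · right
    exact (mul_right_cancel₀ h0 h1).symm

theorem covEigenvalue_antitone (D : Measure (EuclideanSpace ℝ (Fin d))) :
    Antitone (covEigenvalue D) := fun _ _ hij =>
  (covMatrix_isHermitian D).eigenvalues₀_antitone (by simpa using hij)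

theorem exists_perm_covEigenvalue (D : Measure (EuclideanSpace ℝ (Fin d))) :
    ∃ σ : Equiv.Perm (Fin d),
      ∀ i, covEigenvalue D i = (covMatrix_isHermitian D).eigenvalues (σ i) := by
  refine ⟨(finCongr (Fintype.card_fin d).symm).trans
    (Fintype.equivOfCardEq (Fintype.card_fin _)), fun i => ?_⟩
  simp [covEigenvalue, Matrix.IsHermitian.eigenvalues]

theorem sum_covEigenvalue_gaussianSpike {θ : ℝ} (hθ : 0 ≤ θ) {v : EuclideanSpace ℝ (Fin d)}
    (hv : ‖v‖ = 1) : ∑ i, covEigenvalue (gaussianSpike θ v) i = d + θ := by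
  obtain ⟨σ, hσ⟩ := exists_perm_covEigenvalue (gaussianSpike θ v)
  simp_rw [hσ]
  rw [Equiv.sum_comp σ, ← trace_covMatrix_gaussianSpike hθ hv,
    (covMatrix_isHermitian (gaussianSpike θ v)).trace_eq_sum_eigenvalues]
  rfl

/-- Each eigenvalue exceeds 1 by 0 or θ, and by the trace the excesses sum to θ. So the largest is
not 1, and the first two cannot both be 1 + θ. -/
theorem covEigenvalue_gaussianSpike (hd : 2 ≤ d) {θ : ℝ} (hθ : 0 < θ)
    {v : EuclideanSpace ℝ (Fin d)} (hv : ‖v‖ = 1) :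
    covEigenvalue (gaussianSpike θ v) ⟨0, by omega⟩ = 1 + θ ∧
      covEigenvalue (gaussianSpike θ v) ⟨1, by omega⟩ = 1 := by
  have hanti := covEigenvalue_antitone (gaussianSpike θ v)
  have hsum := sum_covEigenvalue_gaussianSpike hθ.le hv
  have hval : ∀ i, covEigenvalue (gaussianSpike θ v) i = 1 ∨
      covEigenvalue (gaussianSpike θ v) i = 1 + θ := fun i => by
    obtain ⟨σ, hσ⟩ := exists_perm_covEigenvalue (gaussianSpike θ v)
    rw [hσ]
    exact eigenvalues_gaussianSpike hθ.le hv _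
  set l := covEigenvalue (gaussianSpike θ v)
  have hge : ∀ i, 0 ≤ l i - 1 := fun i => by rcases hval i with h | h <;> rw [h] <;> linarith
  have hsum' : ∑ i, (l i - 1) = θ := by simp [hsum]
  have h0 : l ⟨0, by omega⟩ = 1 + θ := by
    refine (hval _).resolve_left fun h => ?_
    have : ∑ i, (l i - 1) ≤ ∑ i : Fin d, 0 := Finset.sum_le_sum fun i _ => by
      have := hanti (show (⟨0, by omega⟩ : Fin d) ≤ i from Nat.zero_le _)
      linarith
    simp only [Finset.sum_const_zero] at this
    linarith
  refine ⟨h0, (hval _).resolve_right fun h => ?_⟩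
  have hne : (⟨0, by omega⟩ : Fin d) ≠ ⟨1, by omega⟩ := by simp
  have := Finset.sum_le_sum_of_subset_of_nonneg
    (Finset.subset_univ {(⟨0, by omega⟩ : Fin d), ⟨1, by omega⟩})
    (f := fun i => l i - 1) (fun i _ _ => hge i)
  rw [Finset.sum_pair hne, hsum', h0, h] at this
  linarith

theorem eigengap_gaussianSpike (hd : 2 ≤ d) {θ : ℝ} (hθ : 0 < θ)
    {v : EuclideanSpace ℝ (Fin d)} (hv : ‖v‖ = 1) :
    eigengap hd (gaussianSpike θ v) = θ / (1 + θ) := by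
  obtain ⟨h0, h1⟩ := covEigenvalue_gaussianSpike hd hθ hv
  rw [eigengap, h0, h1, add_sub_cancel_left]

theorem isTopEigenvector_gaussianSpike (hd : 2 ≤ d) {θ : ℝ} (hθ : 0 < θ)
    {v : EuclideanSpace ℝ (Fin d)} (hv : ‖v‖ = 1) :
    IsTopEigenvector hd (gaussianSpike θ v) v := by
  refine ⟨hv, ?_⟩
  rw [(covEigenvalue_gaussianSpike hd hθ hv).1, toEuclideanCLM_covMatrix_gaussianSpike hθ.le,
    real_inner_self_eq_norm_sq, hv, add_smul, one_smul]
  simp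

/-- The eigenvalue equation at 1 + θ reduces to ⟪v, w⟫ v = w. -/
theorem IsTopEigenvector.eq_or_eq_neg (hd : 2 ≤ d) {θ : ℝ} (hθ : 0 < θ)
    {v w : EuclideanSpace ℝ (Fin d)} (hv : ‖v‖ = 1)
    (hw : IsTopEigenvector hd (gaussianSpike θ v) w) : w = v ∨ w = -v := by
  obtain ⟨hw1, h⟩ := hw
  rw [(covEigenvalue_gaussianSpike hd hθ hv).1, toEuclideanCLM_covMatrix_gaussianSpike hθ.le,
    add_smul, one_smul, add_right_inj, mul_smul] at h
  have h2 : ⟪v, w⟫ • v = w := smul_right_injective _ hθ.ne' h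
  have h3 : |⟪v, w⟫| = 1 := by
    have := congrArg norm h2
    rwa [norm_smul, hv, hw1, mul_one] at this
  rcases eq_or_eq_neg_of_abs_eq h3 with h4 | h4 <;> rw [h4] at h2
  · left; simpa using h2.symm
  · right; simpa using h2.symm

theorem signLoss_neg (w v : EuclideanSpace ℝ (Fin d)) : signLoss w (-v) = signLoss w v := by
  rw [signLoss, signLoss, sub_neg_eq_add, ← sub_eq_add_neg, min_comm]

theorem one_le_specNorm_covMatrix_gaussianSpike {θ : ℝ} (hθ : 0 ≤ θ)
    {v : EuclideanSpace ℝ (Fin d)} (hv : ‖v‖ = 1) :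
    1 ≤ specNorm (covMatrix (gaussianSpike θ v)) := by
  have h := (Matrix.toEuclideanCLM (𝕜 := ℝ) (covMatrix (gaussianSpike θ v))).le_opNorm v
  rw [toEuclideanCLM_covMatrix_gaussianSpike hθ, real_inner_self_eq_norm_sq, hv] at h
  have h2 : v + (θ * 1 ^ 2) • v = (1 + θ) • v := by rw [add_smul]; simp
  rw [h2, norm_smul, hv, mul_one, mul_one, Real.norm_eq_abs, abs_of_nonneg (by linarith)] at h
  rw [specNorm]
  linarith

/-! ### The fourth-moment matrix and the variance parameter -/

theorem outer_sq_apply (a : EuclideanSpace ℝ (Fin d)) (i j : Fin d) :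
    (outer a ^ 2) i j = ∑ k, a.ofLp k ^ 2 * (a.ofLp i * a.ofLp j) := by
  rw [pow_two, Matrix.mul_apply]
  simp only [outer, Matrix.vecMulVec_apply]
  exact Finset.sum_congr rfl fun k _ => by ring

theorem abs_sq_mul_mul_le (p q r : ℝ) : |p ^ 2 * (q * r)| ≤ (2 * p ^ 4 + q ^ 4 + r ^ 4) / 4 := by
  rw [abs_le]
  constructor <;> nlinarith [sq_nonneg (p ^ 2 - q * r), sq_nonneg (p ^ 2 + q * r),
    sq_nonneg (q ^ 2 - r ^ 2)]

theorem integrable_inner_sq_mul_inner_mul_inner {θ : ℝ} (hθ : 0 ≤ θ)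
    (v p q r : EuclideanSpace ℝ (Fin d)) :
    Integrable (fun a => ⟪p, a⟫ ^ 2 * (⟪q, a⟫ * ⟪r, a⟫)) (gaussianSpike θ v) := by
  have hi := fun x => integrable_inner_pow_gaussianSpike hθ v x 4
  exact (((((hi p).const_mul 2).add (hi q)).add (hi r)).div_const 4).mono'
    (by fun_prop) (ae_of_all _ fun a => abs_sq_mul_mul_le _ _ _)

theorem integral_inner_sq_mul_inner_mul_inner_le {θ : ℝ} (hθ : 0 ≤ θ) (hθ9 : θ ≤ 9)
    {v p q r : EuclideanSpace ℝ (Fin d)} (hv : ‖v‖ = 1) (hp : ‖p‖ = 1) (hq : ‖q‖ = 1)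
    (hr : ‖r‖ = 1) :
    ∫ a, ⟪p, a⟫ ^ 2 * (⟪q, a⟫ * ⟪r, a⟫) ∂(gaussianSpike θ v) ≤ 48 * Real.exp 5 := by
  have hi := fun x => integrable_inner_pow_gaussianSpike hθ v x 4
  have hl := fun {x} => integral_inner_pow_four_gaussianSpike_le (d := d) (u := x) hθ hθ9 hv
  calc ∫ a, ⟪p, a⟫ ^ 2 * (⟪q, a⟫ * ⟪r, a⟫) ∂(gaussianSpike θ v)
      ≤ ∫ a, (2 * ⟪p, a⟫ ^ 4 + ⟪q, a⟫ ^ 4 + ⟪r, a⟫ ^ 4) / 4 ∂(gaussianSpike θ v) :=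
        integral_mono (integrable_inner_sq_mul_inner_mul_inner hθ v p q r)
          (((((hi p).const_mul 2).add (hi q)).add (hi r)).div_const 4)
          fun a => (le_abs_self _).trans (abs_sq_mul_mul_le _ _ _)
    _ ≤ 48 * Real.exp 5 := by
        have hs : Integrable (fun a => 2 * ⟪p, a⟫ ^ 4 + ⟪q, a⟫ ^ 4) (gaussianSpike θ v) :=
          ((hi p).const_mul 2).add (hi q)
        rw [integral_div, integral_add hs (hi r),
          integral_add ((hi p).const_mul 2) (hi q), integral_const_mul]
        linarith [hl hp, hl hq, hl hr]

/-- Since (aaᵀ)² = ‖a‖² aaᵀ, splitting ‖a‖² into coordinates leaves d expectations, each controlled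
by fourth moments of marginals. -/
theorem inner_fourthMatrix_gaussianSpike {θ : ℝ} (hθ : 0 ≤ θ)
    (v x y : EuclideanSpace ℝ (Fin d)) :
    ⟪y, Matrix.toEuclideanCLM (𝕜 := ℝ) (fourthMatrix (gaussianSpike θ v)) x⟫ =
      ∑ k, ∫ a, ⟪EuclideanSpace.single k (1 : ℝ), a⟫ ^ 2 * (⟪y, a⟫ * ⟪x, a⟫)
        ∂(gaussianSpike θ v) := by
  have hi := integrable_inner_sq_mul_inner_mul_inner hθ v
  have hM : ∀ i j, fourthMatrix (gaussianSpike θ v) i j =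
      ∑ k, ∫ a, a.ofLp k ^ 2 * (a.ofLp i * a.ofLp j) ∂(gaussianSpike θ v) := fun i j => by
    simp only [fourthMatrix, Matrix.of_apply, outer_sq_apply]
    refine integral_finsetSum _ fun k _ => ?_
    simp_rw [ofLp_apply_eq_inner_single]
    exact hi _ _ _
  have hR : ∀ k, ∫ a, ⟪EuclideanSpace.single k (1 : ℝ), a⟫ ^ 2 * (⟪y, a⟫ * ⟪x, a⟫)
      ∂(gaussianSpike θ v) = ∑ i, ∑ j, y.ofLp i * x.ofLp j *
        ∫ a, a.ofLp k ^ 2 * (a.ofLp i * a.ofLp j) ∂(gaussianSpike θ v) := fun k => by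
    have he : ∀ a : EuclideanSpace ℝ (Fin d),
        ⟪EuclideanSpace.single k (1 : ℝ), a⟫ ^ 2 * (⟪y, a⟫ * ⟪x, a⟫) =
        ∑ i, ∑ j, y.ofLp i * x.ofLp j * (⟪EuclideanSpace.single k (1 : ℝ), a⟫ ^ 2 *
          (⟪EuclideanSpace.single i (1 : ℝ), a⟫ * ⟪EuclideanSpace.single j (1 : ℝ), a⟫)) :=
        fun a => by
      simp_rw [← ofLp_apply_eq_inner_single]
      rw [PiLp.inner_apply, PiLp.inner_apply, Finset.sum_mul_sum, Finset.mul_sum]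
      refine Finset.sum_congr rfl fun i _ => ?_
      rw [Finset.mul_sum]
      refine Finset.sum_congr rfl fun j _ => ?_
      simp only [RCLike.inner_apply, conj_trivial]
      ring
    simp_rw [he]
    rw [integral_finsetSum _ fun i _ => integrable_finsetSum _ fun j _ => (hi _ _ _).const_mul _]
    refine Finset.sum_congr rfl fun i _ => ?_
    rw [integral_finsetSum _ fun j _ => (hi _ _ _).const_mul _]
    simp_rw [integral_const_mul, ← ofLp_apply_eq_inner_single]
  rw [Matrix.inner_toEuclideanCLM]
  simp only [dotProduct, Matrix.mulVec, hM, hR, Finset.mul_sum, Finset.sum_mul]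
  conv_rhs => rw [Finset.sum_comm]
  refine Finset.sum_congr rfl fun i _ => ?_
  conv_rhs => rw [Finset.sum_comm]
  exact Finset.sum_congr rfl fun j _ => Finset.sum_congr rfl fun k _ => by ring

theorem specNorm_fourthMatrix_gaussianSpike_le {θ : ℝ} (hθ : 0 ≤ θ) (hθ9 : θ ≤ 9)
    {v : EuclideanSpace ℝ (Fin d)} (hv : ‖v‖ = 1) :
    specNorm (fourthMatrix (gaussianSpike θ v)) ≤ d * (48 * Real.exp 5) := by
  refine ContinuousLinearMap.opNorm_le_of_unit_norm (by positivity) fun x hx => ?_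
  set w := Matrix.toEuclideanCLM (𝕜 := ℝ) (fourthMatrix (gaussianSpike θ v)) x with hw
  by_cases h0 : w = 0
  · rw [h0, norm_zero]; positivity
  have hn : 0 < ‖w‖ := norm_pos_iff.mpr h0
  have hy : ‖‖w‖⁻¹ • w‖ = 1 := by rw [norm_smul, norm_inv, norm_norm, inv_mul_cancel₀ hn.ne']
  have h : ⟪‖w‖⁻¹ • w, w⟫ = ‖w‖ := by
    rw [real_inner_smul_left, real_inner_self_eq_norm_sq]; field_simp
  rw [← h, hw, inner_fourthMatrix_gaussianSpike hθ, ← hw]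
  refine (Finset.sum_le_card_nsmul _ _ (48 * Real.exp 5) fun k _ => ?_).trans (by simp)
  exact integral_inner_sq_mul_inner_mul_inner_le hθ hθ9 hv (by simp) hy hx

theorem nvar_gaussianSpike_le {θ : ℝ} (hθ : 0 ≤ θ) (hθ9 : θ ≤ 9)
    {v : EuclideanSpace ℝ (Fin d)} (hv : ‖v‖ = 1) :
    nvar (gaussianSpike θ v) ≤ d * (48 * Real.exp 5) := by
  have h1 := one_le_specNorm_covMatrix_gaussianSpike hθ hv
  refine (div_le_self (norm_nonneg _) (one_le_pow₀ h1)).trans ?_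
  exact specNorm_fourthMatrix_gaussianSpike_le hθ hθ9 hv

/-! ### Likelihood ratios and the two-point bound -/

/-- The log-likelihood ratio of a sample between the spike directions `w` and `v`. -/
noncomputable def logLik (θ : ℝ) (v w : EuclideanSpace ℝ (Fin d)) {n : ℕ}
    (a : Fin n → EuclideanSpace ℝ (Fin d)) : ℝ :=
  ∑ i, θ / (1 + θ) / 2 * (⟪w, a i⟫ ^ 2 - ⟪v, a i⟫ ^ 2)

@[fun_prop]
theorem measurable_logLik (θ : ℝ) (v w : EuclideanSpace ℝ (Fin d)) (n : ℕ) :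
    Measurable (logLik θ v w (n := n)) := by
  unfold logLik
  fun_prop

theorem gaussianSpike_eq_withDensity_gaussianSpike {θ : ℝ} (hθ : 0 ≤ θ) (hd : 0 < d)
    {v w : EuclideanSpace ℝ (Fin d)} (hv : ‖v‖ = 1) (hw : ‖w‖ = 1) :
    gaussianSpike θ w = (gaussianSpike θ v).withDensity fun a =>
      ENNReal.ofReal (Real.exp (θ / (1 + θ) / 2 * (⟪w, a⟫ ^ 2 - ⟪v, a⟫ ^ 2))) := by
  rw [gaussianSpike_eq_withDensity hθ hd hv, gaussianSpike_eq_withDensity hθ hd hw,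
    ← withDensity_mul _ (by fun_prop) (by fun_prop)]
  congr 1
  ext a
  rw [Pi.mul_apply, ← ENNReal.ofReal_mul (by positivity), mul_assoc, ← Real.exp_add]
  congr 3
  ring

theorem pi_gaussianSpike_eq_withDensity {θ : ℝ} (hθ : 0 ≤ θ) (hd : 0 < d)
    {v w : EuclideanSpace ℝ (Fin d)} (hv : ‖v‖ = 1) (hw : ‖w‖ = 1) (n : ℕ) :
    (Measure.pi fun _ : Fin n => gaussianSpike θ w) =
      (Measure.pi fun _ : Fin n => gaussianSpike θ v).withDensity fun a =>
        ENNReal.ofReal (Real.exp (logLik θ v w a)) := by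
  have h := gaussianSpike_eq_withDensity_gaussianSpike hθ hd hv hw
  have : ∀ _ : Fin n, SigmaFinite ((gaussianSpike θ v).withDensity fun a =>
      ENNReal.ofReal (Real.exp (θ / (1 + θ) / 2 * (⟪w, a⟫ ^ 2 - ⟪v, a⟫ ^ 2)))) := fun _ => by
    rw [← h]; infer_instance
  rw [h, pi_withDensity (fun _ : Fin n => gaussianSpike θ v) (f := fun _ a =>
    ENNReal.ofReal (Real.exp (θ / (1 + θ) / 2 * (⟪w, a⟫ ^ 2 - ⟪v, a⟫ ^ 2))))
    (fun _ => by fun_prop) this]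
  congr 1
  ext a
  rw [logLik, Real.exp_sum, ENNReal.ofReal_prod_of_nonneg fun _ _ => (Real.exp_pos _).le]

theorem integrable_inner_sq_sub_inner_sq {θ : ℝ} (hθ : 0 ≤ θ)
    (v w : EuclideanSpace ℝ (Fin d)) :
    Integrable (fun a => θ / (1 + θ) / 2 * (⟪w, a⟫ ^ 2 - ⟪v, a⟫ ^ 2)) (gaussianSpike θ v) :=
  ((integrable_inner_pow_gaussianSpike hθ v w 2).sub
    (integrable_inner_pow_gaussianSpike hθ v v 2)).const_mul _

theorem integrable_inner_sq_sub_inner_sq_eval {θ : ℝ} (hθ : 0 ≤ θ)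
    (v w : EuclideanSpace ℝ (Fin d)) {n : ℕ} (i : Fin n) :
    Integrable (fun a : Fin n → EuclideanSpace ℝ (Fin d) =>
      θ / (1 + θ) / 2 * (⟪w, a i⟫ ^ 2 - ⟪v, a i⟫ ^ 2))
      (Measure.pi fun _ : Fin n => gaussianSpike θ v) :=
  integrable_comp_eval (μ := fun _ : Fin n => gaussianSpike θ v) (i := i)
    (integrable_inner_sq_sub_inner_sq hθ v w)

theorem integrable_logLik {θ : ℝ} (hθ : 0 ≤ θ) (v w : EuclideanSpace ℝ (Fin d)) (n : ℕ) :
    Integrable (logLik θ v w) (Measure.pi fun _ : Fin n => gaussianSpike θ v) :=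
  integrable_finsetSum _ fun i _ => integrable_inner_sq_sub_inner_sq_eval hθ v w i

/-- This is minus the Kullback–Leibler divergence of the sample law for v from that for w. -/
theorem integral_logLik {θ : ℝ} (hθ : 0 ≤ θ) {v w : EuclideanSpace ℝ (Fin d)} (hv : ‖v‖ = 1)
    (hw : ‖w‖ = 1) (n : ℕ) :
    ∫ a, logLik θ v w a ∂(Measure.pi fun _ : Fin n => gaussianSpike θ v) =
      -(n * (θ / (1 + θ) / 2 * (θ * (1 - ⟪v, w⟫ ^ 2)))) := by
  have hi := integrable_inner_sq_sub_inner_sq hθ v w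
  have h1 : ∫ a, θ / (1 + θ) / 2 * (⟪w, a⟫ ^ 2 - ⟪v, a⟫ ^ 2) ∂(gaussianSpike θ v) =
      -(θ / (1 + θ) / 2 * (θ * (1 - ⟪v, w⟫ ^ 2))) := by
    rw [integral_const_mul, integral_sub (integrable_inner_pow_gaussianSpike hθ v w 2)
      (integrable_inner_pow_gaussianSpike hθ v v 2), integral_inner_sq_gaussianSpike hθ,
      integral_inner_sq_gaussianSpike hθ, real_inner_self_eq_norm_sq, hv, hw]
    ring
  unfold logLik
  rw [integral_finsetSum _ fun i _ => integrable_inner_sq_sub_inner_sq_eval hθ v w i]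
  have h2 : ∀ i : Fin n, ∫ a : Fin n → EuclideanSpace ℝ (Fin d),
      θ / (1 + θ) / 2 * (⟪w, a i⟫ ^ 2 - ⟪v, a i⟫ ^ 2)
        ∂(Measure.pi fun _ : Fin n => gaussianSpike θ v) =
      -(θ / (1 + θ) / 2 * (θ * (1 - ⟪v, w⟫ ^ 2))) := fun i => by
    rw [← h1]
    exact integral_comp_eval (μ := fun _ : Fin n => gaussianSpike θ v) (i := i)
      hi.aestronglyMeasurable
  simp_rw [h2]
  simp

theorem integrable_exp_logLik {θ : ℝ} (hθ : 0 ≤ θ) (hd : 0 < d)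
    {v w : EuclideanSpace ℝ (Fin d)} (hv : ‖v‖ = 1) (hw : ‖w‖ = 1) (n : ℕ) :
    Integrable (fun a => Real.exp (logLik θ v w a))
        (Measure.pi fun _ : Fin n => gaussianSpike θ v) ∧
      ∫ a, Real.exp (logLik θ v w a) ∂(Measure.pi fun _ : Fin n => gaussianSpike θ v) = 1 := by
  have h : ∫⁻ a, ENNReal.ofReal (Real.exp (logLik θ v w a))
      ∂(Measure.pi fun _ : Fin n => gaussianSpike θ v) = 1 := by
    rw [← setLIntegral_univ, ← withDensity_apply _ .univ,
      ← pi_gaussianSpike_eq_withDensity hθ hd hv hw, measure_univ]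
  constructor
  · refine ⟨by fun_prop, ?_⟩
    rw [hasFiniteIntegral_iff_ofReal (ae_of_all _ fun _ => (Real.exp_pos _).le), h]
    exact ENNReal.one_lt_top
  · rw [integral_eq_lintegral_of_nonneg_ae (ae_of_all _ fun _ => (Real.exp_pos _).le)
      (by fun_prop), h, ENNReal.toReal_one]

theorem ofReal_integral_le_lintegral_ofReal {α : Type*} [MeasurableSpace α] {μ : Measure α}
    {f : α → ℝ} (hf : Integrable f μ) :
    ENNReal.ofReal (∫ x, f x ∂μ) ≤ ∫⁻ x, ENNReal.ofReal (f x) ∂μ := by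
  rw [integral_eq_lintegral_pos_part_sub_lintegral_neg_part hf]
  refine ENNReal.ofReal_le_of_le_toReal ?_
  linarith [ENNReal.toReal_nonneg (a := ∫⁻ x, ENNReal.ofReal (-f x) ∂μ)]

/-- The pointwise inequality behind the two-point bound: `min 1 (exp l) ≥ ½ exp (l / 2) - …`. -/
theorem half_add_sub_exp_le (l p : ℝ) (h0 : 0 ≤ p) (h1 : p ≤ 1) :
    1 / 2 * (1 + l / 2) - (1 + Real.exp l) / 8 ≤ p + (1 - p) * Real.exp l := by
  have h2 : l / 2 + 1 ≤ Real.exp (l / 2) := Real.add_one_le_exp _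
  have h3 : Real.exp l = Real.exp (l / 2) ^ 2 := by rw [← Real.exp_nat_mul]; congr 1; push_cast; ring
  rw [h3]
  set r := Real.exp (l / 2)
  have hr : 0 < r := Real.exp_pos _
  -- The right side is at least m = min(1, r²). With M = max(1, r²), AM-GM gives r = √(mM) ≤ 2m +
  -- M/8, and M ≤ 1 + r².
  have h4 : 1 / 2 * r - (1 + r ^ 2) / 8 ≤ p + (1 - p) * r ^ 2 := by
    rcases le_total r 1 with h | h
    · nlinarith [mul_nonneg h0 (show 0 ≤ 1 - r ^ 2 by nlinarith), sq_nonneg (3 * r - 1),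
        sq_nonneg (r - 1 / 3)]
    · nlinarith [mul_nonneg (sub_nonneg.2 h1) (show 0 ≤ r ^ 2 - 1 by nlinarith),
        sq_nonneg (r - 2)]
  linarith

/-- Here φ and ψ are the error probabilities of a randomized test. Moving both integrals to the law
for v gives the integrand φ + (1 - φ) exp l, with l the log-likelihood ratio. Its pointwise lower
bound uses only l, whose mean is minus the divergence, and exp l, whose mean is 1. -/
theorem two_point_lower_bound {θ : ℝ} (hθ : 0 ≤ θ) (hd : 0 < d)
    {v w : EuclideanSpace ℝ (Fin d)} (hv : ‖v‖ = 1) (hw : ‖w‖ = 1) (n : ℕ)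
    {φ ψ : (Fin n → EuclideanSpace ℝ (Fin d)) → ℝ≥0∞} (hφ : Measurable φ)
    (hφψ : ∀ a, φ a + ψ a = 1) :
    ENNReal.ofReal (1 / 4 - n * (θ / (1 + θ) * θ * (1 - ⟪v, w⟫ ^ 2)) / 8) ≤
      ∫⁻ a, φ a ∂(Measure.pi fun _ : Fin n => gaussianSpike θ v) +
        ∫⁻ a, ψ a ∂(Measure.pi fun _ : Fin n => gaussianSpike θ w) := by
  obtain ⟨hR, hR1⟩ := integrable_exp_logLik hθ hd hv hw n
  have hL := integrable_logLik hθ v w n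
  rw [pi_gaussianSpike_eq_withDensity hθ hd hv hw,
    lintegral_withDensity_eq_lintegral_mul_non_measurable _ (by fun_prop)
      (ae_of_all _ fun _ => ENNReal.ofReal_lt_top), ← lintegral_add_left hφ]
  set P := Measure.pi fun _ : Fin n => gaussianSpike θ v
  have i1 : Integrable (fun a => 1 / 2 * (1 + logLik θ v w a / 2)) P :=
    ((integrable_const 1).add (hL.div_const 2)).const_mul _
  have i2 : Integrable (fun a => (1 + Real.exp (logLik θ v w a)) / 8) P :=
    ((integrable_const 1).add hR).div_const 8
  have hint : ∫ a, (1 / 2 * (1 + logLik θ v w a / 2) - (1 + Real.exp (logLik θ v w a)) / 8) ∂P =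
      1 / 4 - n * (θ / (1 + θ) * θ * (1 - ⟪v, w⟫ ^ 2)) / 8 := by
    rw [integral_sub i1 i2, integral_const_mul, integral_div,
      integral_add (integrable_const _) (hL.div_const 2), integral_add (integrable_const _) hR,
      integral_div, hR1, integral_logLik hθ hv hw]
    simp only [integral_const, probReal_univ, one_smul]
    ring
  rw [← hint]
  refine (ofReal_integral_le_lintegral_ofReal (i1.sub i2)).trans (lintegral_mono fun a => ?_)
  have hφ1 : φ a ≤ 1 := hφψ a ▸ le_self_add
  have hψ1 : ψ a ≤ 1 := hφψ a ▸ le_add_self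
  have hφt : φ a ≠ ⊤ := (hφ1.trans_lt ENNReal.one_lt_top).ne
  have hψt : ψ a ≠ ⊤ := (hψ1.trans_lt ENNReal.one_lt_top).ne
  have hsum : (φ a).toReal + (ψ a).toReal = 1 := by
    rw [← ENNReal.toReal_add hφt hψt, hφψ, ENNReal.toReal_one]
  have hp := half_add_sub_exp_le (logLik θ v w a) (φ a).toReal ENNReal.toReal_nonneg
    (by linarith [ENNReal.toReal_nonneg (a := ψ a)])
  rw [← hsum, add_sub_cancel_left, hsum] at hp
  refine (ENNReal.ofReal_le_ofReal hp).trans ?_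
  rw [ENNReal.ofReal_add ENNReal.toReal_nonneg (by positivity),
    ENNReal.ofReal_mul ENNReal.toReal_nonneg, ENNReal.ofReal_toReal hφt, ENNReal.ofReal_toReal hψt]
  simp [mul_comm]

/-! ### Assouad's cube of spike directions -/

/-- Flip the coordinate `i` of a point of the Boolean cube. -/
def flip {ι : Type*} [DecidableEq ι] (i : ι) (τ : ι → Bool) : ι → Bool :=
  Function.update τ i (!τ i)

theorem flip_involutive {ι : Type*} [DecidableEq ι] (i : ι) :
    Function.Involutive (flip i) := fun τ => by
  simp [flip]

/-- Averaging over the Boolean cube, as in Assouad's lemma. -/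
theorem exists_card_mul_le_two_mul_sum {ι : Type*} [Fintype ι] [DecidableEq ι] (s : Finset ι)
    (E : (ι → Bool) → ι → ℝ≥0∞) (c : ℝ≥0∞)
    (h : ∀ τ, ∀ i ∈ s, c ≤ E τ i + E (flip i τ) i) :
    ∃ τ, s.card * c ≤ 2 * ∑ i ∈ s, E τ i := by
  have hsum : ∑ _τ : ι → Bool, s.card * c ≤ ∑ τ, 2 * ∑ i ∈ s, E τ i := by
    -- Flipping a coordinate permutes the cube, so both ends of each edge contribute the same total.
    have h2 : ∀ i, ∑ τ, E (flip i τ) i = ∑ τ, E τ i := fun i =>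
      Equiv.sum_comp (flip_involutive i).toPerm fun τ => E τ i
    calc ∑ _τ : ι → Bool, s.card * c = ∑ _τ : ι → Bool, ∑ _i ∈ s, c := by simp
      _ ≤ ∑ τ, ∑ i ∈ s, (E τ i + E (flip i τ) i) :=
          Finset.sum_le_sum fun τ _ => Finset.sum_le_sum fun i hi => h τ i hi
      _ = ∑ τ, 2 * ∑ i ∈ s, E τ i := by
          simp_rw [Finset.sum_add_distrib, two_mul, Finset.sum_add_distrib]
          congr 1
          rw [Finset.sum_comm, Finset.sum_congr rfl fun i _ => h2 i, Finset.sum_comm]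
  obtain ⟨τ, _, hτ⟩ := ENNReal.exists_le_of_sum_le Finset.univ_nonempty hsum
  exact ⟨τ, hτ⟩

/-- The unit vectors close to the `i₀`-th basis vector, indexed by the Boolean cube. -/
noncomputable def spikeDir (i₀ : Fin d) (δ : ℝ) (τ : Fin d → Bool) : EuclideanSpace ℝ (Fin d) :=
  WithLp.toLp 2 fun i => if i = i₀ then √(1 - (d - 1) * δ ^ 2) else if τ i then δ else -δ

theorem spikeDir_apply_sq_of_ne {i₀ i : Fin d} (hi : i ≠ i₀) (δ : ℝ) (τ : Fin d → Bool) :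
    (spikeDir i₀ δ τ).ofLp i ^ 2 = δ ^ 2 := by
  simp only [spikeDir, if_neg hi]
  split_ifs <;> ring

theorem norm_spikeDir (i₀ : Fin d) {δ : ℝ} (hδ : (d - 1) * δ ^ 2 ≤ 1) (τ : Fin d → Bool) :
    ‖spikeDir i₀ δ τ‖ = 1 := by
  have h : ‖spikeDir i₀ δ τ‖ ^ 2 = 1 := by
    rw [EuclideanSpace.real_norm_sq_eq, ← Finset.add_sum_erase _ _ (Finset.mem_univ i₀),
      Finset.sum_congr rfl fun i hi => spikeDir_apply_sq_of_ne (Finset.ne_of_mem_erase hi) δ τ,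
      Finset.sum_const, Finset.card_erase_of_mem (Finset.mem_univ i₀)]
    have hd : 1 ≤ d := i₀.pos
    simp only [spikeDir, if_true, Finset.card_univ, Fintype.card_fin, nsmul_eq_mul]
    rw [Real.sq_sqrt (by linarith)]
    push_cast [hd]
    ring
  nlinarith [norm_nonneg (spikeDir i₀ δ τ)]

/-- The two unit vectors differ by 2δ in a single coordinate. -/
theorem inner_spikeDir_flip {i₀ i : Fin d} (hi : i ≠ i₀) {δ : ℝ} (hδ : (d - 1) * δ ^ 2 ≤ 1)
    (τ : Fin d → Bool) :
    ⟪spikeDir i₀ δ τ, spikeDir i₀ δ (flip i τ)⟫ = 1 - 2 * δ ^ 2 := by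
  have h := norm_sub_sq_real (spikeDir i₀ δ τ) (spikeDir i₀ δ (flip i τ))
  rw [norm_spikeDir i₀ hδ, norm_spikeDir i₀ hδ, EuclideanSpace.real_norm_sq_eq,
    Finset.sum_eq_single i] at h
  · have h2 : (spikeDir i₀ δ τ - spikeDir i₀ δ (flip i τ)).ofLp i ^ 2 = 4 * δ ^ 2 := by
      simp only [spikeDir, flip, PiLp.sub_apply, if_neg hi, Function.update_self]
      cases τ i <;> simp <;> ring
    rw [h2] at h
    linarith
  · intro j _ hj
    simp [spikeDir, flip, hj]
  · simp

/-- The sign that aligns `w` with the `i₀`-th basis vector. -/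
noncomputable def alignSign (i₀ : Fin d) (w : EuclideanSpace ℝ (Fin d)) : ℝ :=
  if 0 ≤ w.ofLp i₀ then 1 else -1

/-- The outputs from which the `i`-th sign of the spike direction is not read off as `b`. -/
def errorSet (i₀ i : Fin d) (b : Bool) : Set (EuclideanSpace ℝ (Fin d)) :=
  {w | ¬(0 ≤ alignSign i₀ w * w.ofLp i ↔ b = true)}

theorem measurableSet_errorSet (i₀ i : Fin d) (b : Bool) : MeasurableSet (errorSet i₀ i b) := by
  have h : Measurable fun w : EuclideanSpace ℝ (Fin d) => alignSign i₀ w :=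
    Measurable.ite (measurableSet_le measurable_const (by fun_prop)) measurable_const
      measurable_const
  have h2 : MeasurableSet {w : EuclideanSpace ℝ (Fin d) | 0 ≤ alignSign i₀ w * w.ofLp i} :=
    measurableSet_le measurable_const (h.mul (by fun_prop))
  cases b
  · simpa [errorSet] using h2
  · simpa [errorSet, Set.compl_ofPred] using h2.compl

theorem errorSet_not (i₀ i : Fin d) (b : Bool) : errorSet i₀ i (!b) = (errorSet i₀ i b)ᶜ := by
  ext w
  cases b <;> simp [errorSet]

open Classical in
-- Against the aligned copy of v, a misread coordinate lies on the wrong side of zero and costs at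
-- least δ². Against the opposite copy, coordinate i₀ alone costs 1 - (d-1)δ², which by `hδ` covers
-- even d - 1 errors.
theorem sum_errorSet_le_signLoss (i₀ : Fin d) {δ : ℝ} (hδ0 : 0 ≤ δ)
    (hδ : 2 * ((d - 1) * δ ^ 2) ≤ 1) (τ : Fin d → Bool) (w : EuclideanSpace ℝ (Fin d)) :
    ∑ i ∈ Finset.univ.erase i₀, (if w ∈ errorSet i₀ i (τ i) then δ ^ 2 else 0) ≤
      signLoss w (spikeDir i₀ δ τ) := by
  set v := spikeDir i₀ δ τ with hv
  set s := alignSign i₀ w with hs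
  have hd : 1 ≤ d := i₀.pos
  have hd' : (1 : ℝ) ≤ d := by exact_mod_cast hd
  have hs2 : s ^ 2 = 1 := by rw [hs, alignSign]; split_ifs <;> norm_num
  have hs0 : 0 ≤ s * w.ofLp i₀ := by rw [hs, alignSign]; split_ifs <;> linarith
  have hv0 : v.ofLp i₀ = √(1 - (d - 1) * δ ^ 2) := by simp [hv, spikeDir]
  have hexp : ∀ x : EuclideanSpace ℝ (Fin d), ‖w - x‖ ^ 2 =
      (w.ofLp i₀ - x.ofLp i₀) ^ 2 + ∑ i ∈ Finset.univ.erase i₀, (w.ofLp i - x.ofLp i) ^ 2 :=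
    fun x => by
      rw [EuclideanSpace.real_norm_sq_eq, ← Finset.add_sum_erase _ _ (Finset.mem_univ i₀)]
      rfl
  have h1 : ∑ i ∈ Finset.univ.erase i₀, (if w ∈ errorSet i₀ i (τ i) then δ ^ 2 else 0) ≤
      ‖w - s • v‖ ^ 2 := by
    rw [hexp]
    refine le_add_of_nonneg_of_le (sq_nonneg _) (Finset.sum_le_sum fun i hi => ?_)
    split_ifs with hw
    · have h : (w.ofLp i - (s • v).ofLp i) ^ 2 = (s * w.ofLp i - v.ofLp i) ^ 2 := by
        simp only [PiLp.smul_apply, smul_eq_mul]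
        linear_combination (v.ofLp i ^ 2 - w.ofLp i ^ 2) * hs2
      rw [h]
      simp only [errorSet, Set.mem_ofPred_eq, ← hs] at hw
      have hvi : v.ofLp i = if τ i then δ else -δ := by
        simp [hv, spikeDir, Finset.ne_of_mem_erase hi]
      rw [hvi]
      cases hτ : τ i
      · simp only [hτ, Bool.false_eq_true, iff_false, not_not, if_false] at hw ⊢
        nlinarith
      · simp only [hτ, iff_true, not_le, if_true] at hw ⊢
        nlinarith
    · positivity
  have h2 : ∑ i ∈ Finset.univ.erase i₀, (if w ∈ errorSet i₀ i (τ i) then δ ^ 2 else 0) ≤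
      ‖w - (-s) • v‖ ^ 2 := by
    calc ∑ i ∈ Finset.univ.erase i₀, (if w ∈ errorSet i₀ i (τ i) then δ ^ 2 else 0)
        ≤ ∑ _i ∈ Finset.univ.erase i₀, δ ^ 2 := Finset.sum_le_sum fun i _ => by
          split_ifs <;> nlinarith
      _ = (d - 1) * δ ^ 2 := by simp [Finset.card_erase_of_mem, hd]
      _ ≤ 1 - (d - 1) * δ ^ 2 := by linarith
      _ = v.ofLp i₀ ^ 2 := by rw [hv0, Real.sq_sqrt (by linarith)]
      _ ≤ (w.ofLp i₀ - ((-s) • v).ofLp i₀) ^ 2 := by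
          have h : (w.ofLp i₀ - ((-s) • v).ofLp i₀) ^ 2 = (s * w.ofLp i₀ + v.ofLp i₀) ^ 2 := by
            simp only [PiLp.smul_apply, smul_eq_mul]
            linear_combination (v.ofLp i₀ ^ 2 - w.ofLp i₀ ^ 2) * hs2
          rw [h]
          have : 0 ≤ v.ofLp i₀ := hv0 ▸ Real.sqrt_nonneg _
          nlinarith [mul_nonneg hs0 this]
      _ ≤ ‖w - (-s) • v‖ ^ 2 := by
          rw [hexp]
          exact le_add_of_nonneg_right (Finset.sum_nonneg fun i _ => sq_nonneg _)
  rcases sq_eq_sq_iff_eq_or_eq_neg.mp (hs2.trans (one_pow 2).symm) with h | h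
  · rw [h] at h1 h2
    exact le_min (by simpa using h1) (by simpa using h2)
  · rw [h] at h1 h2
    exact le_min (by simpa using h2) (by simpa using h1)

theorem sum_lintegral_errorSet_le_risk (i₀ : Fin d) {δ : ℝ} (hδ0 : 0 ≤ δ)
    (hδ : 2 * ((d - 1) * δ ^ 2) ≤ 1) (τ : Fin d → Bool) {n : ℕ}
    (D : Measure (EuclideanSpace ℝ (Fin d))) [IsProbabilityMeasure D]
    (κ : Kernel (Fin n → EuclideanSpace ℝ (Fin d)) (EuclideanSpace ℝ (Fin d))) :
    ENNReal.ofReal (δ ^ 2) * ∑ i ∈ Finset.univ.erase i₀,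
        ∫⁻ a, κ a (errorSet i₀ i (τ i)) ∂(Measure.pi fun _ : Fin n => D) ≤
      risk D κ (spikeDir i₀ δ τ) := by
  classical
  have hm := fun i => measurableSet_errorSet i₀ i (τ i)
  rw [← lintegral_finsetSum _ fun i _ => κ.measurable_coe (hm i),
    ← lintegral_const_mul _ (Finset.measurable_sum _ fun i _ => κ.measurable_coe (hm i))]
  refine lintegral_mono fun a => ?_
  calc ENNReal.ofReal (δ ^ 2) * ∑ i ∈ Finset.univ.erase i₀, κ a (errorSet i₀ i (τ i))
      = ∫⁻ w, ∑ i ∈ Finset.univ.erase i₀,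
          (errorSet i₀ i (τ i)).indicator (fun _ => ENNReal.ofReal (δ ^ 2)) w ∂(κ a) := by
        rw [lintegral_finsetSum _ fun i _ => measurable_const.indicator (hm i), Finset.mul_sum]
        exact Finset.sum_congr rfl fun i _ => (lintegral_indicator_const (hm i) _).symm
    _ ≤ ∫⁻ w, ENNReal.ofReal (signLoss w (spikeDir i₀ δ τ)) ∂(κ a) := by
        refine lintegral_mono fun w => ?_
        refine le_trans (le_of_eq ?_)
          (ENNReal.ofReal_le_ofReal (sum_errorSet_le_signLoss i₀ hδ0 hδ τ w))
        rw [ENNReal.ofReal_sum_of_nonneg fun i _ => by split_ifs <;> positivity]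
        refine Finset.sum_congr rfl fun i _ => ?_
        rw [Set.indicator_apply]
        split_ifs <;> simp

/-! ### The minimax bound -/

theorem exists_spike_risk_ge (hd : 2 ≤ d) {θ : ℝ} (hθ : 0 < θ) {n : ℕ} (hn : 0 < n)
    (hdn : d ≤ 2 * n * (θ / (1 + θ) * θ))
    (κ : Kernel (Fin n → EuclideanSpace ℝ (Fin d)) (EuclideanSpace ℝ (Fin d)))
    [IsMarkovKernel κ] :
    ∃ v : EuclideanSpace ℝ (Fin d), ‖v‖ = 1 ∧
      ENNReal.ofReal ((d - 1) / (64 * n * (θ / (1 + θ) * θ))) ≤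
        risk (gaussianSpike θ v) κ v := by
  have hn' : (0 : ℝ) < n := by exact_mod_cast hn
  have hd' : (2 : ℝ) ≤ d := by exact_mod_cast hd
  set q := θ / (1 + θ) * θ
  have hq : 0 < q := by positivity
  let i₀ : Fin d := ⟨0, by omega⟩
  -- Neighbours have 1 - ⟪v, w⟫² ≤ 4δ², so this δ makes the two-point bound at least 1/4 - 1/8. The
  -- hypothesis `hdn` is what keeps 2(d-1)δ² ≤ 1.
  set δ := √(1 / (4 * n * q))
  have hδ0 : 0 ≤ δ := Real.sqrt_nonneg _
  have hδ2 : δ ^ 2 = 1 / (4 * n * q) := Real.sq_sqrt (by positivity)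
  have hδn : n * q * δ ^ 2 = 1 / 4 := by rw [hδ2]; field_simp
  have hδ : 2 * ((d - 1) * δ ^ 2) ≤ 1 := by
    have : (d - 1) * δ ^ 2 ≤ 2 * n * q * δ ^ 2 := by gcongr; linarith
    linarith
  have hδ1 : (d - 1) * δ ^ 2 ≤ 1 := by nlinarith
  obtain ⟨τ, hτ⟩ := exists_card_mul_le_two_mul_sum (Finset.univ.erase i₀)
    (fun τ i => ∫⁻ a, κ a (errorSet i₀ i (τ i))
      ∂(Measure.pi fun _ : Fin n => gaussianSpike θ (spikeDir i₀ δ τ)))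
    (ENNReal.ofReal (1 / 8)) (by
      intro τ i hi
      have hi' := Finset.ne_of_mem_erase hi
      have hm := measurableSet_errorSet i₀ i (τ i)
      have hfl : flip i τ i = !τ i := by simp [flip]
      simp only [hfl, errorSet_not]
      refine le_trans (ENNReal.ofReal_le_ofReal ?_) (two_point_lower_bound hθ.le (by omega)
        (norm_spikeDir i₀ hδ1 τ) (norm_spikeDir i₀ hδ1 (flip i τ)) n
        (κ.measurable_coe hm) fun a => prob_add_prob_compl hm)
      rw [inner_spikeDir_flip hi' hδ1]
      have : 0 ≤ n * q * (δ ^ 2) ^ 2 := by positivity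
      nlinarith)
  refine ⟨spikeDir i₀ δ τ, norm_spikeDir i₀ hδ1 τ, le_trans ?_
    (sum_lintegral_errorSet_le_risk i₀ hδ0 hδ τ (gaussianSpike θ (spikeDir i₀ δ τ)) κ)⟩
  set S := ∑ i ∈ Finset.univ.erase i₀, ∫⁻ a, κ a (errorSet i₀ i (τ i))
      ∂(Measure.pi fun _ : Fin n => gaussianSpike θ (spikeDir i₀ δ τ))
  have hcard : (((Finset.univ.erase i₀).card : ℕ) : ℝ≥0∞) = ENNReal.ofReal (d - 1) := by
    rw [Finset.card_erase_of_mem (Finset.mem_univ _), Finset.card_univ, Fintype.card_fin,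
      ← ENNReal.ofReal_natCast, Nat.cast_sub (by omega), Nat.cast_one]
  rw [hcard, ← ENNReal.ofReal_mul (by linarith)] at hτ
  have h2 : (2 : ℝ≥0∞) = ENNReal.ofReal 2 := by simp
  have h3 : ENNReal.ofReal ((d - 1) / 16) ≤ S := by
    calc ENNReal.ofReal ((d - 1) / 16)
        = ENNReal.ofReal (1 / 2) * ENNReal.ofReal ((d - 1) * (1 / 8)) := by
          rw [← ENNReal.ofReal_mul (by norm_num)]; congr 1; ring
      _ ≤ ENNReal.ofReal (1 / 2) * (2 * S) := by gcongr
      _ = S := by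
          rw [← mul_assoc, h2, ← ENNReal.ofReal_mul (by norm_num)]; simp
  refine le_trans (le_of_eq ?_) (mul_le_mul_right h3 _)
  rw [← ENNReal.ofReal_mul (by positivity), hδ2]
  congr 1
  field_simp
  ring

end OnlinePCA

theorem mainTheorem4 :
    ∃ c : ℝ, 0 < c ∧
      ∀ (d : ℕ) (hd : 2 ≤ d) (g : ℝ), 0 < g → g < 0.9 →
        ∃ N : ℕ, ∀ n : ℕ, N ≤ n →
          ∀ κ : Kernel (Fin n → EuclideanSpace ℝ (Fin d)) (EuclideanSpace ℝ (Fin d)),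
            IsMarkovKernel κ →
              ∃ (D : Measure (EuclideanSpace ℝ (Fin d))) (θ : ℝ)
                (v : EuclideanSpace ℝ (Fin d)),
                0 < θ ∧ ‖v‖ = 1 ∧ D = OnlinePCA.gaussianSpike θ v ∧
                OnlinePCA.eigengap hd D = g ∧
                OnlinePCA.IsTopEigenvector hd D v ∧
                ∀ v₁ : EuclideanSpace ℝ (Fin d), OnlinePCA.IsTopEigenvector hd D v₁ →
                  ENNReal.ofReal (c * (OnlinePCA.nvar D / (g ^ 2 * n))) ≤
                    OnlinePCA.risk D κ v₁ := by
  -- The factor 1280 is 64 · 2 · 10, from d - 1 ≥ d/2 and 1 - g ≥ 1/10; the rest cancels the bound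
  -- on the variance parameter.
  refine ⟨(1280 * (48 * Real.exp 5))⁻¹, by positivity, fun d hd g hg0 hg9 => ?_⟩
  norm_num at hg9
  have hg1 : 0 < 1 - g := by linarith
  set θ := g / (1 - g) with hθ_def
  have hθ : 0 < θ := by positivity
  have hgap : θ / (1 + θ) = g := by rw [hθ_def]; field_simp; ring
  have hθ9 : θ ≤ 9 := by rw [hθ_def, div_le_iff₀ hg1]; linarith
  -- The threshold ensures d ≤ 2ngθ, so that the cube fits on the sphere near one axis.
  refine ⟨max 1 ⌈d / (2 * (g * θ))⌉₊, fun n hn κ _ => ?_⟩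
  have hn1 : 0 < n := (le_max_left _ _).trans hn
  have hn' : (0 : ℝ) < n := by exact_mod_cast hn1
  have hdn : (d : ℝ) ≤ 2 * n * (θ / (1 + θ) * θ) := by
    have h := (Nat.le_ceil _).trans (Nat.cast_le (α := ℝ).2 ((le_max_right _ _).trans hn))
    rw [div_le_iff₀ (by positivity)] at h
    rw [hgap]
    linarith
  obtain ⟨v, hv, hrisk⟩ := OnlinePCA.exists_spike_risk_ge hd hθ hn1 hdn κ
  refine ⟨OnlinePCA.gaussianSpike θ v, θ, v, hθ, hv, rfl,
    (OnlinePCA.eigengap_gaussianSpike hd hθ hv).trans hgap,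
    OnlinePCA.isTopEigenvector_gaussianSpike hd hθ hv, fun v₁ hv₁ => ?_⟩
  have hrv : OnlinePCA.risk (OnlinePCA.gaussianSpike θ v) κ v₁ =
      OnlinePCA.risk (OnlinePCA.gaussianSpike θ v) κ v := by
    rcases hv₁.eq_or_eq_neg hd hθ hv with h | h
    · rw [h]
    · rw [h]
      simp only [OnlinePCA.risk, OnlinePCA.signLoss_neg]
  rw [hrv]
  refine (ENNReal.ofReal_le_ofReal ?_).trans hrisk
  have hnv := OnlinePCA.nvar_gaussianSpike_le hθ.le hθ9 hv
  have hd' : (2 : ℝ) ≤ d := by exact_mod_cast hd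
  rw [hgap]
  calc (1280 * (48 * Real.exp 5))⁻¹ * (OnlinePCA.nvar (OnlinePCA.gaussianSpike θ v) / (g ^ 2 * n))
      ≤ (1280 * (48 * Real.exp 5))⁻¹ * (d * (48 * Real.exp 5) / (g ^ 2 * n)) := by gcongr
    _ = d / 1280 / (g ^ 2 * n) := by field_simp
    _ ≤ ((d - 1) * (1 - g) / 64) / (g ^ 2 * n) := by
        refine div_le_div_of_nonneg_right ?_ (by positivity)
        nlinarith
    _ = (d - 1) / (64 * n * (g * θ)) := by rw [hθ_def]; field_simp
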